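/- Let $n,k,l$ be positive integers with $l\le k\le n-1$. The stopping rule $\mathcal R_n(k,l)$ selects a term of a permutation $a_1,\dots,a_n$ of $\{1,\dots,n\}$ as follows: let $t$ be the $l$-th lowest value among $a_1,\dots,a_k$; select the first of the terms $a_{k+1},\dots,a_n$ that is less than $t$ if there is one, and $a_n$ otherwise. For a positive integer $d$, the reward for selecting the value $s$ is $n+1-s$ if $s\le d$ and $0$ otherwise, and $V_{n,d}(k,l)$ denotes the expected reward of $\mathcal R_n(k,l)$ when all $n!$ permutations are equally likely. Let $$c_d=\lim_{n\to\infty}\frac{\max\{V_{n,d}(k,l)\mid 1\le l\le k\le n-1\}}{n}.$$ (1) The limit $c_1$ exists and $c_1=1/\mathrm e\approx 0.36788$. Moreover, $V_{n,1}(k,l)\le V_{n,1}(k,1)$ for all $1\le l\le k\le n-1$. (2) The equation $2x-2\log x=3$ has exactly two positive real roots; let $x$ be the smaller one. Then $x\approx 0.30171$, the limit $c_2$ exists, and $c_2=2x-x^2\approx 0.51239$. Moreover, for fixed $n$ and $k$, $V_{n,2}(k,l)$ is non-increasing in $l$ for $2\le l\le k$; as $n\to\infty$, $$\frac{\max_{1\le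 k\le n-1}V_{n,2}(k,1)}{n}\to 2x-x^2,\qquad \frac{\max_{2\le k\le n-1}V_{n,2}(k,2)}{n}\to\frac12;$$ and $\max_k V_{n,2}(k,2)<\max_k V_{n,2}(k,1)$ for all sufficiently large $n$. Here each $\approx$ means that the error is less than $5\cdot 10^{-6}$. -/

import Mathlib

open Filter Topology

noncomputable section

namespace Secretary

/-- A permutation of `Fin n` is read as a sequence `a_1, …, a_n` with the values `1, …, n`:
`rank σ i` is `a_i`, the absolute rank (1 is best) of the applicant interviewed `i`-th.
The value outside `1 ≤ i ≤ n` is irrelevant. -/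
def rank {n : ℕ} (σ : Equiv.Perm (Fin n)) (i : ℕ) : ℕ :=
  if h : 1 ≤ i ∧ i ≤ n then (σ ⟨i - 1, by omega⟩ : ℕ) + 1 else 0

/-- The test value: the `l`-th lowest value among `a_1, …, a_k` (for `1 ≤ l ≤ k ≤ n`).
`Nat.nth` counts from `0`. -/
def testValue {n : ℕ} (σ : Equiv.Perm (Fin n)) (k l : ℕ) : ℕ :=
  Nat.nth (fun m => ∃ i, 1 ≤ i ∧ i ≤ k ∧ rank σ i = m) (l - 1)

/-- The set of all `i` with `1 ≤ i ≤ n - k` for which `a_{k+i}` is below the test value. -/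
def successSet {n : ℕ} (σ : Equiv.Perm (Fin n)) (k l : ℕ) : Finset ℕ :=
  (Finset.Icc 1 (n - k)).filter fun i => rank σ (k + i) < testValue σ k l

/-- The value selected by the stopping rule with parameters `k` and `l`: the first of
`a_{k+1}, …, a_n` that is below the test value, or `a_n` if there is none. -/
def selected {n : ℕ} (σ : Equiv.Perm (Fin n)) (k l : ℕ) : ℕ :=
  if h : (successSet σ k l).Nonempty then rank σ (k + (successSet σ k l).min' h)
  else rank σ (k + (n - k))

/-- The reward for hiring the applicant of absolute rank `s`. -/
def reward (n d s : ℕ) : ℝ :=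
  if s ≤ d then (n : ℝ) + 1 - s else 0

/-- `V_{n,d}(k,l)`: the expected reward when all `n!` orders are equally likely. -/
def expectedReward (n d k l : ℕ) : ℝ :=
  (∑ σ : Equiv.Perm (Fin n), reward n d (selected σ k l)) / (n.factorial : ℝ)

/-- The values `V_{n,d}(k,l)` for all admissible `k`, `l`, that is, `1 ≤ l ≤ k ≤ n - 1`. -/
def rewardSet (n d : ℕ) : Set ℝ :=
  {v | ∃ k l : ℕ, 1 ≤ l ∧ l ≤ k ∧ k < n ∧ v = expectedReward n d k l}

/-- The values `V_{n,d}(k,l)` for a fixed `l` and all admissible `k`. -/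
def rewardSetAt (n d l : ℕ) : Set ℝ :=
  {v | ∃ k : ℕ, 1 ≤ l ∧ l ≤ k ∧ k < n ∧ v = expectedReward n d k l}

/-- `max {V_{n,d}(k,l) | k, l}`; a true maximum as soon as `n ≥ 2`, see `maxReward_isGreatest`. -/
def maxReward (n d : ℕ) : ℝ := sSup (rewardSet n d)

/-- `max {V_{n,d}(k,l) | k}` for a fixed `l`; see `maxRewardAt_isGreatest`. -/
def maxRewardAt (n d l : ℕ) : ℝ := sSup (rewardSetAt n d l)

theorem rewardSet_finite (n d : ℕ) : (rewardSet n d).Finite := by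
  refine (((Set.finite_Iio n).prod (Set.finite_Iio n)).image
    fun p : ℕ × ℕ => expectedReward n d p.1 p.2).subset ?_
  rintro v ⟨k, l, _, hlk, hkn, rfl⟩
  exact ⟨(k, l), ⟨hkn, lt_of_le_of_lt hlk hkn⟩, rfl⟩

theorem maxReward_isGreatest {n : ℕ} (hn : 2 ≤ n) (d : ℕ) :
    IsGreatest (rewardSet n d) (maxReward n d) :=
  ⟨Set.Nonempty.csSup_mem ⟨_, 1, 1, le_rfl, le_rfl, hn, rfl⟩ (rewardSet_finite n d),
    fun _ hv => le_csSup (rewardSet_finite n d).bddAbove hv⟩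

theorem maxRewardAt_isGreatest {n l : ℕ} (hl : 1 ≤ l) (hn : l < n) (d : ℕ) :
    IsGreatest (rewardSetAt n d l) (maxRewardAt n d l) := by
  have hsub : rewardSetAt n d l ⊆ rewardSet n d := by
    rintro v ⟨k, h1, h2, h3, rfl⟩
    exact ⟨k, l, h1, h2, h3, rfl⟩
  have hfin := (rewardSet_finite n d).subset hsub
  exact ⟨Set.Nonempty.csSup_mem ⟨_, l, hl, le_rfl, hn, rfl⟩ hfin,
    fun _ hv => le_csSup hfin.bddAbove hv⟩

end Secretary

end

namespace Secretary

open Finset Equiv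

/-! A term after the first `k` beats the test value iff fewer than `l` of the first `k` terms are
lower than it. A value at most `l` always does, so it is selected from position `m` iff no position
in `[k, m)` holds a term that beats the test value. Raising `l` makes such an earlier term more
likely. Hence `V_{n,d}(k,l)` is non-increasing in `l ≥ d`, and only `l = 1` matters for `d = 1`,
only `l = 1, 2` for `d = 2`.

No position in `[k, M)` beats the test value iff the `l` lowest of the first `M` terms all lie among
the first `k`. By symmetry this has probability `C(k,l) / C(M,l)`, also when conditioned on events
that ignore rearrangements of the first `M` terms. This yields exact formulas; the remaining case,
value 2 with `l = 1`, is settled by the position of value 1.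

With `t = k / n`, dividing by `n` gives `-t log t` for `d = l = 1`, and for `d = 2` the functions
`-2t log t - t(1 - t)` (`l = 1`) and `2t(1 - t)` (`l = 2`), up to `O(1/n)` uniformly in `k`. So the
maxima converge to the maxima of these functions: `1/e`, `2x - x²` and `1/2`. Here `2t - 2 log t -
3` is the derivative of the second function, which explains the equation for `x`. As `2x - x² >
1/2`, `l = 1` eventually wins. -/

/-! ### The stopping rule in terms of lower counts (positions and values counted from 0) -/

/-- The number of the first `M` terms that are lower than the term at position `j`. -/
def lowerCount {n : ℕ} (σ : Perm (Fin n)) (M : ℕ) (j : Fin n) : ℕ :=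
  #{i : Fin n | (i : ℕ) < M ∧ σ i < σ j}

theorem rank_succ {n : ℕ} (σ : Perm (Fin n)) (i : Fin n) : rank σ ((i : ℕ) + 1) = σ i + 1 := by
  have := i.isLt
  unfold rank
  rw [dif_pos (by omega)]
  simp

theorem rank_lt_testValue_iff {n : ℕ} (σ : Perm (Fin n)) {k l : ℕ} (hl : 1 ≤ l) (hlk : l ≤ k)
    (j : Fin n) (hkj : k ≤ j) :
    rank σ (j + 1) < testValue σ k l ↔ lowerCount σ k j < l := by
  classical
  set p : ℕ → Prop := fun m => ∃ i, 1 ≤ i ∧ i ≤ k ∧ rank σ i = m with hp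
  have hj := j.isLt
  have mem_p : ∀ m, p m ↔ ∃ i : Fin n, (i : ℕ) < k ∧ (σ i : ℕ) + 1 = m := by
    intro m
    constructor
    · rintro ⟨i, h1, h2, h3⟩
      refine ⟨⟨i - 1, by omega⟩, by simp; omega, ?_⟩
      rw [← rank_succ, ← h3]
      congr 1
      simp
      omega
    · rintro ⟨i, h1, h2⟩
      exact ⟨i + 1, by omega, by omega, by rw [rank_succ, h2]⟩
  have inj : Function.Injective fun i : Fin n => (σ i : ℕ) + 1 := by
    intro a b hab
    simpa [Fin.val_inj] using hab
  have hcard : #{i : Fin n | (i : ℕ) < k} = k := by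
    rw [Fin.card_filter_val_lt]
    omega
  -- At least `k ≥ l` values have been seen, so `Nat.nth` does not take its default value 0.
  have hn : ∀ hf : (Set.ofPred p).Finite, l - 1 < #hf.toFinset := by
    intro hf
    have : k ≤ #hf.toFinset := by
      conv_lhs => rw [← hcard, ← card_image_of_injective _ inj]
      refine card_le_card fun m hm => ?_
      simp only [mem_image, mem_filter, mem_univ, true_and] at hm
      rw [Set.Finite.mem_toFinset]
      exact (mem_p m).2 hm
    omega
  have hcount : Nat.count p (rank σ (j + 1)) = lowerCount σ k j := by
    rw [Nat.count_eq_card_filter_range, lowerCount, ← card_image_of_injective _ inj]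
    congr 1
    ext m
    simp only [mem_filter, mem_range, mem_p, mem_image, mem_univ, true_and, rank_succ]
    constructor
    · rintro ⟨h, i, hi, rfl⟩
      exact ⟨i, ⟨hi, by rw [Fin.lt_def]; omega⟩, rfl⟩
    · rintro ⟨i, ⟨hi, hij⟩, rfl⟩
      rw [Fin.lt_def] at hij
      exact ⟨by omega, i, hi, rfl⟩
  -- The term at `j` is not among the first `k`, so it cannot equal the test value.
  have hnot : ¬ p (rank σ (j + 1)) := by
    rw [mem_p, rank_succ]
    rintro ⟨i, hi, h⟩
    have := inj h
    subst this
    omega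
  have hmem : p (Nat.nth p (l - 1)) := Nat.nth_mem _ hn
  change rank σ (j + 1) < Nat.nth p (l - 1) ↔ _
  constructor
  · intro h
    have := Nat.count_monotone p h.le
    rw [Nat.count_nth hn, hcount] at this
    omega
  · intro h
    by_contra hcon
    have hne : Nat.nth p (l - 1) ≠ rank σ (j + 1) := fun h => hnot (h ▸ hmem)
    have := Nat.count_monotone p (show Nat.nth p (l - 1) + 1 ≤ rank σ (j + 1) by omega)
    rw [Nat.count_nth_succ hn, hcount] at this
    omega

/-- The final alternative is the default choice: once the last position is reached, its term is
taken whether or not it beats the test value. -/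
theorem selected_eq_iff {n : ℕ} (σ : Perm (Fin n)) {k l : ℕ} (hl : 1 ≤ l) (hlk : l ≤ k)
    (hkn : k < n) (v : Fin n) :
    selected σ k l = v + 1 ↔
      k ≤ (σ.symm v : ℕ) ∧ (∀ j : Fin n, k ≤ (j : ℕ) → j < σ.symm v → l ≤ lowerCount σ k j) ∧
        (lowerCount σ k (σ.symm v) < l ∨ (σ.symm v : ℕ) = n - 1) := by
  have hmem : ∀ j : Fin n, k ≤ (j : ℕ) →
      ((j : ℕ) + 1 - k ∈ successSet σ k l ↔ lowerCount σ k j < l) := by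
    intro j hj
    have := j.isLt
    rw [← rank_lt_testValue_iff σ hl hlk j hj, successSet, mem_filter, mem_Icc,
      show k + ((j : ℕ) + 1 - k) = j + 1 by omega]
    constructor
    · exact fun h => h.2
    · exact fun h => ⟨by omega, h⟩
  have hval : ∀ j : Fin n, rank σ (j + 1) = v + 1 ↔ j = σ.symm v := by
    intro j
    rw [rank_succ, Equiv.eq_symm_apply, Fin.ext_iff]
    omega
  unfold selected
  split_ifs with h
  · set i := (successSet σ k l).min' h with hi
    have him : i ∈ successSet σ k l := min'_mem _ _
    have hir := (mem_Icc.1 (mem_filter.1 him).1)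
    obtain ⟨j, hj⟩ : ∃ j : Fin n, (j : ℕ) = k + i - 1 := ⟨⟨k + i - 1, by omega⟩, rfl⟩
    have hj1 : i = j + 1 - k := by omega
    have hjs : lowerCount σ k j < l := (hmem j (by omega)).1 (hj1 ▸ him)
    have hbefore : ∀ j' : Fin n, k ≤ (j' : ℕ) → j' < j → l ≤ lowerCount σ k j' := by
      intro j' hj' hlt
      by_contra hcon
      have := min'_le _ _ ((hmem j' hj').2 (not_le.1 hcon))
      rw [← hi] at this
      rw [Fin.lt_def] at hlt
      omega
    rw [show k + i = j + 1 by omega, hval]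
    constructor
    · intro h
      rw [← h]
      exact ⟨by omega, hbefore, Or.inl hjs⟩
    · rintro ⟨h1, h2, h3⟩
      rcases lt_trichotomy j (σ.symm v) with h | h | h
      · have := h2 j (by omega) h
        omega
      · exact h
      · have h4 := hbefore _ h1 h
        rw [Fin.lt_def] at h
        have := j.isLt
        omega
  · have hnone : ∀ j : Fin n, k ≤ (j : ℕ) → l ≤ lowerCount σ k j := by
      intro j hj
      by_contra hcon
      exact h ⟨_, (hmem j hj).2 (not_le.1 hcon)⟩
    obtain ⟨j, hj⟩ : ∃ j : Fin n, (j : ℕ) = n - 1 := ⟨⟨n - 1, by omega⟩, rfl⟩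
    rw [show k + (n - k) = j + 1 by omega, hval]
    constructor
    · intro h
      rw [← h]
      exact ⟨by omega, fun j hj _ => hnone j hj, Or.inr hj⟩
    · rintro ⟨h1, h2, h3⟩
      have := hnone _ h1
      rw [Fin.ext_iff]
      omega

theorem one_le_selected {n : ℕ} (σ : Perm (Fin n)) {k l : ℕ} (hkn : k < n) :
    1 ≤ selected σ k l := by
  have hr : ∀ i, 1 ≤ i → i ≤ n → 1 ≤ rank σ i := by
    intro i h1 h2
    rw [rank, dif_pos ⟨h1, h2⟩]
    omega
  unfold selected
  split_ifs with h
  · have := mem_Icc.1 (mem_filter.1 (min'_mem _ h)).1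
    exact hr _ (by omega) (by omega)
  · exact hr _ (by omega) (by omega)

/-! ### Monotonicity in `l` for `l ≥ d` -/

theorem lowerCount_le_val {n : ℕ} (σ : Perm (Fin n)) (k : ℕ) (j : Fin n) :
    lowerCount σ k j ≤ σ j := by
  have : #{i : Fin n | σ i < σ j} = (σ j : ℕ) := by
    rw [← card_map σ.toEmbedding, ← Fin.card_Iio]
    congr 1
    ext m
    simp only [mem_map_equiv, mem_filter, mem_univ, true_and, mem_Iio, apply_symm_apply]
  rw [← this]
  exact card_le_card fun i hi => by
    simp only [mem_filter, mem_univ, true_and] at hi ⊢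
    exact hi.2

theorem reward_nonneg {n d s : ℕ} (hd : d ≤ n) : 0 ≤ reward n d s := by
  unfold reward
  split_ifs with h
  · have : (s : ℝ) ≤ n := by exact_mod_cast h.trans hd
    linarith
  · exact le_rfl

/-- A value at most `d` that is selected with the parameter `l' ≥ l ≥ d` is also selected with
the parameter `l`. -/
theorem selected_eq_of_le {n : ℕ} (σ : Perm (Fin n)) {d k l l' : ℕ} (hl : 1 ≤ l) (hdl : d ≤ l)
    (hll : l ≤ l') (hlk : l' ≤ k) (hkn : k < n) (hs : selected σ k l' ≤ d) :
    selected σ k l = selected σ k l' := by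
  have h1 := one_le_selected σ (l := l') hkn
  obtain ⟨v, hv⟩ : ∃ v : Fin n, selected σ k l' = v + 1 :=
    ⟨⟨selected σ k l' - 1, by omega⟩, by simp; omega⟩
  rw [hv, selected_eq_iff σ hl (hll.trans hlk) hkn]
  obtain ⟨h2, h3, -⟩ := (selected_eq_iff σ (hl.trans hll) hlk hkn v).1 hv
  refine ⟨h2, fun j hj hjv => hll.trans (h3 j hj hjv), Or.inl ?_⟩
  have := lowerCount_le_val σ k (σ.symm v)
  rw [apply_symm_apply] at this
  omega

/-- The comparison holds for each permutation: whenever `l'` earns a positive reward, `l` selects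
the same value. -/
theorem expectedReward_anti {n d k l l' : ℕ} (hl : 1 ≤ l) (hdl : d ≤ l)
    (hll : l ≤ l') (hlk : l' ≤ k) (hkn : k < n) :
    expectedReward n d k l' ≤ expectedReward n d k l := by
  refine div_le_div_of_nonneg_right (sum_le_sum fun σ _ => ?_) (Nat.cast_nonneg _)
  by_cases hs : selected σ k l' ≤ d
  · rw [selected_eq_of_le σ hl hdl hll hlk hkn hs]
  · rw [reward, if_neg hs]
    exact reward_nonneg (by omega)

/-! ### Symmetry under rearrangement of positions -/

/-- If right translations of the group permute the fibers of `f` on `Q` transitively, then all these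
fibers have the same size. -/
theorem card_mul_card_filter_mem {G X : Type*} [Group G] [DecidableEq X]
    (Q : Finset G) (f : G → X) (S : Finset X) (hf : ∀ σ ∈ Q, f σ ∈ S)
    (h : ∀ x ∈ S, ∀ y ∈ S, ∃ π : G, ∀ σ ∈ Q, f σ = x → σ * π ∈ Q ∧ f (σ * π) = y)
    {U : Finset X} (hU : U ⊆ S) :
    #S * #{σ ∈ Q | f σ ∈ U} = #U * #Q := by
  have hle : ∀ x ∈ S, ∀ y ∈ S, #{σ ∈ Q | f σ = x} ≤ #{σ ∈ Q | f σ = y} := by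
    intro x hx y hy
    obtain ⟨π, hπ⟩ := h x hx y hy
    refine card_le_card_of_injOn (· * π) ?_ (fun a _ b _ hab => mul_right_cancel hab)
    intro σ hσ
    have hσ := mem_filter.1 hσ
    exact mem_filter.2 (hπ σ hσ.1 hσ.2)
  have hU' : #{σ ∈ Q | f σ ∈ U} = ∑ x ∈ U, #{σ ∈ Q | f σ = x} := by
    have hmaps : Set.MapsTo f ({σ ∈ Q | f σ ∈ U} : Finset G) U := fun σ hσ => (mem_filter.1 hσ).2
    rw [card_eq_sum_card_fiberwise hmaps]
    refine sum_congr rfl fun x hx => ?_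
    rw [filter_filter]
    congr 1
    refine filter_congr fun σ _ => ?_
    constructor
    · exact fun h => h.2
    · exact fun h => ⟨h ▸ hx, h⟩
  have hQ : #Q = ∑ x ∈ S, #{σ ∈ Q | f σ = x} := card_eq_sum_card_fiberwise hf
  rcases U.eq_empty_or_nonempty with rfl | ⟨u, hu⟩
  · simp
  have hc : ∀ x ∈ S, #{σ ∈ Q | f σ = x} = #{σ ∈ Q | f σ = u} := fun x hx =>
    le_antisymm (hle x hx u (hU hu)) (hle u (hU hu) x hx)
  rw [hU', hQ, sum_congr rfl hc, sum_congr rfl fun x hx => hc x (hU hx), sum_const, sum_const,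
    smul_eq_mul, smul_eq_mul]
  ring

theorem lowerCount_lt_of_lt {n : ℕ} (σ : Perm (Fin n)) {M : ℕ} {i j : Fin n} (hi : (i : ℕ) < M)
    (h : σ i < σ j) : lowerCount σ M i < lowerCount σ M j := by
  refine card_lt_card ⟨fun a ha => ?_, fun hsub => ?_⟩
  · simp only [mem_filter, mem_univ, true_and] at ha ⊢
    exact ⟨ha.1, ha.2.trans h⟩
  · have : i ∈ ({a : Fin n | (a : ℕ) < M ∧ σ a < σ i} : Finset (Fin n)) :=
      hsub (by simp [hi, h])
    simp at this

theorem lt_of_lowerCount_lt {n : ℕ} (σ : Perm (Fin n)) {M : ℕ} {i j : Fin n} (hj : (j : ℕ) < M)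
    (h : lowerCount σ M i < lowerCount σ M j) : σ i < σ j := by
  by_contra hcon
  rcases (not_lt.1 hcon).eq_or_lt with h' | h'
  · rw [σ.injective h'] at h
    exact lt_irrefl _ h
  · exact absurd (lowerCount_lt_of_lt σ hj h') (by omega)

/-- The positions of the `l` lowest among the first `M` terms. -/
def lowest {n : ℕ} (σ : Perm (Fin n)) (M l : ℕ) : Finset (Fin n) :=
  {i : Fin n | (i : ℕ) < M ∧ lowerCount σ M i < l}

theorem card_filter_val_lt {n M : ℕ} (hM : M ≤ n) : #{i : Fin n | (i : ℕ) < M} = M := by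
  rw [Fin.card_filter_val_lt]
  omega

/-- On the first `M` positions `lowerCount σ M` is the relative rank, a bijection onto `range M`. -/
theorem card_lowest {n : ℕ} (σ : Perm (Fin n)) {M l : ℕ} (hl : l ≤ M) (hM : M ≤ n) :
    #(lowest σ M l) = l := by
  have hinj : Set.InjOn (lowerCount σ M) ({i : Fin n | (i : ℕ) < M} : Finset (Fin n)) := by
    intro a ha b hb hab
    simp only [coe_filter, mem_univ, true_and, Set.mem_ofPred_eq] at ha hb
    rcases lt_trichotomy (σ a) (σ b) with h | h | h
    · have := lowerCount_lt_of_lt σ ha h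
      omega
    · exact σ.injective h
    · have := lowerCount_lt_of_lt σ hb h
      omega
  have hlt : ∀ a : Fin n, (a : ℕ) < M → lowerCount σ M a < M := by
    intro a ha
    conv_rhs => rw [← card_filter_val_lt hM]
    refine card_lt_card ⟨fun i hi => ?_, fun hsub => ?_⟩
    · simp only [mem_filter, mem_univ, true_and] at hi ⊢
      exact hi.1
    · have : a ∈ ({i : Fin n | (i : ℕ) < M ∧ σ i < σ a} : Finset (Fin n)) :=
        hsub (by simp [ha])
      simp at this
  have himage : ({i : Fin n | (i : ℕ) < M} : Finset (Fin n)).image (lowerCount σ M) = range M := by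
    refine eq_of_subset_of_card_le ?_ ?_
    · intro m hm
      obtain ⟨a, ha, rfl⟩ := mem_image.1 hm
      exact mem_range.2 (hlt a (by simpa using ha))
    · rw [card_image_of_injOn hinj, card_filter_val_lt hM, card_range]
  have hsub : lowest σ M l ⊆ ({i : Fin n | (i : ℕ) < M} : Finset (Fin n)) := by
    intro a ha
    simp only [lowest, mem_filter, mem_univ, true_and] at ha ⊢
    exact ha.1
  rw [← card_image_of_injOn (hinj.mono (coe_subset.2 hsub))]
  conv_rhs => rw [← card_range l]
  congr 1
  ext m
  rw [mem_range]
  constructor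
  · intro hm
    obtain ⟨a, ha, rfl⟩ := mem_image.1 hm
    exact (mem_filter.1 ha).2.2
  · intro hm
    have : m ∈ range M := mem_range.2 (by omega)
    rw [← himage] at this
    obtain ⟨a, ha, rfl⟩ := mem_image.1 this
    refine mem_image_of_mem _ ?_
    simp only [lowest, mem_filter, mem_univ, true_and] at ha ⊢
    exact ⟨ha, hm⟩

/-- A position in `[k, M)` with `l` lower terms before `k` is not among the `l` lowest; conversely,
if the `l` lowest all lie before `k`, they are all lower than any term in `[k, M)`. The event thus
depends only on the set `lowest σ M l`, which is what the symmetry argument needs. -/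
theorem forall_le_lowerCount_iff {n : ℕ} (σ : Perm (Fin n)) {k l M : ℕ} (hlM : l ≤ M)
    (hkM : k ≤ M) (hM : M ≤ n) :
    (∀ j : Fin n, k ≤ (j : ℕ) → (j : ℕ) < M → l ≤ lowerCount σ k j) ↔
      lowest σ M l ⊆ ({i : Fin n | (i : ℕ) < k} : Finset (Fin n)) := by
  constructor
  · intro h i hi
    simp only [lowest, mem_filter, mem_univ, true_and] at hi ⊢
    by_contra hcon
    have h1 := h i (by omega) hi.1
    have h2 : lowerCount σ k i ≤ lowerCount σ M i := card_le_card fun a ha => by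
      simp only [mem_filter, mem_univ, true_and] at ha ⊢
      exact ⟨ha.1.trans_le hkM, ha.2⟩
    omega
  · intro h j hkj hjM
    conv_lhs => rw [← card_lowest σ hlM hM]
    refine card_le_card fun i hi => ?_
    have hik := h hi
    simp only [lowest, mem_filter, mem_univ, true_and] at hi hik ⊢
    refine ⟨hik, lt_of_lowerCount_lt σ hjM (lt_of_lt_of_le hi.2 ?_)⟩
    by_contra hcon
    have := h (show j ∈ lowest σ M l by
      simp only [lowest, mem_filter, mem_univ, true_and]
      exact ⟨hjM, by omega⟩)
    simp only [mem_filter, mem_univ, true_and] at this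
    omega

/-- Permutations that fix everything outside a set act transitively on its subsets of a given
size. -/
theorem exists_perm_mem_iff {α : Type*} [Fintype α] [DecidableEq α] {A S T : Finset α}
    (hS : S ⊆ A) (hT : T ⊆ A) (h : #S = #T) :
    ∃ π : Perm α, (∀ i ∉ A, π i = i) ∧ ∀ i, π i ∈ S ↔ i ∈ T := by
  have e₁ : T ≃ S := Finset.equivOfCardEq h.symm
  have e₂ : (A \ T : Finset α) ≃ (A \ S : Finset α) := Finset.equivOfCardEq (by
    rw [card_sdiff_of_subset hS, card_sdiff_of_subset hT, h])
  -- Glue a bijection `T → S`, a bijection `A \ T → A \ S` and the identity outside `A`.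
  let f : α → α := fun i =>
    if h : i ∈ T then e₁ ⟨i, h⟩ else if h' : i ∈ A \ T then e₂ ⟨i, h'⟩ else i
  have fT : ∀ i (h : i ∈ T), f i = e₁ ⟨i, h⟩ := fun i h => by simp only [f, dif_pos h]
  have fA : ∀ i (h : i ∈ A \ T), f i = e₂ ⟨i, h⟩ := fun i h => by
    simp only [f, dif_neg (Finset.mem_sdiff.1 h).2, dif_pos h]
  have fC : ∀ i, i ∉ A → f i = i := fun i h => by
    simp only [f, dif_neg (fun h' => h (hT h')), dif_neg fun h' => h (Finset.mem_sdiff.1 h').1]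
  have mT : ∀ i, i ∈ T → f i ∈ S := fun i h => by rw [fT i h]; exact (e₁ _).2
  have mA : ∀ i, i ∈ A \ T → f i ∈ A \ S := fun i h => by rw [fA i h]; exact (e₂ _).2
  have hcase : ∀ i, i ∈ T ∨ i ∈ A \ T ∨ i ∉ A := by
    intro i
    rw [Finset.mem_sdiff]
    tauto
  have hinj : Function.Injective f := by
    intro a b hab
    have hA : ∀ i, i ∈ A ↔ f i ∈ A := by
      intro i
      rcases hcase i with h | h | h
      · exact ⟨fun _ => hS (mT i h), fun _ => hT h⟩
      · exact ⟨fun _ => (Finset.mem_sdiff.1 (mA i h)).1, fun _ => (Finset.mem_sdiff.1 h).1⟩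
      · rw [fC i h]
    rcases hcase a with ha | ha | ha
    · rcases hcase b with hb | hb | hb
      · rw [fT a ha, fT b hb] at hab
        simpa using e₁.injective (Subtype.ext hab)
      · exact absurd (hab ▸ mT a ha) (Finset.mem_sdiff.1 (mA b hb)).2
      · exact absurd ((hA b).2 (hab ▸ hS (mT a ha))) hb
    · rcases hcase b with hb | hb | hb
      · exact absurd (hab ▸ mT b hb) (Finset.mem_sdiff.1 (mA a ha)).2
      · rw [fA a ha, fA b hb] at hab
        simpa using e₂.injective (Subtype.ext hab)
      · exact absurd ((hA b).2 (hab ▸ (Finset.mem_sdiff.1 (mA a ha)).1)) hb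
    · have hb : b ∉ A := by rw [hA, ← hab, ← hA]; exact ha
      rw [fC a ha, fC b hb] at hab
      exact hab
  refine ⟨Equiv.ofBijective f (Finite.injective_iff_bijective.1 hinj), fC, fun i => ?_⟩
  change f i ∈ S ↔ i ∈ T
  refine ⟨fun hi => ?_, mT i⟩
  rcases hcase i with h | h | h
  · exact h
  · exact absurd hi (Finset.mem_sdiff.1 (mA i h)).2
  · rw [fC i h] at hi
    exact absurd (hS hi) h

theorem val_lt_iff_of_fixes {n M : ℕ} {π : Perm (Fin n)}
    (hπ : ∀ i : Fin n, M ≤ (i : ℕ) → π i = i) (i : Fin n) : (π i : ℕ) < M ↔ (i : ℕ) < M := by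
  constructor
  · intro h
    by_contra hcon
    rw [hπ i (by omega)] at h
    exact hcon h
  · intro h
    by_contra hcon
    have := π.injective (hπ (π i) (by omega))
    rw [this] at hcon
    exact hcon h

theorem mem_lowest_mul {n M : ℕ} (l : ℕ) (σ : Perm (Fin n)) {π : Perm (Fin n)}
    (hπ : ∀ i : Fin n, M ≤ (i : ℕ) → π i = i) (i : Fin n) :
    i ∈ lowest (σ * π) M l ↔ π i ∈ lowest σ M l := by
  have : lowerCount (σ * π) M i = lowerCount σ M (π i) := by
    unfold lowerCount
    rw [← card_map π.toEmbedding]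
    congr 1
    ext a
    rw [mem_map_equiv, mem_filter, mem_filter]
    simp only [mem_univ, true_and, Perm.mul_apply, apply_symm_apply]
    rw [← val_lt_iff_of_fixes hπ, apply_symm_apply]
  simp only [lowest, mem_filter, mem_univ, true_and, this, val_lt_iff_of_fixes hπ]

/-- In a family of permutations that is invariant under rearrangements of the first `M` terms,
the `l` lowest of the first `M` terms are equally likely to be at any `l` places. -/
theorem choose_mul_card_filter {n k l M : ℕ} (hlk : l ≤ k) (hkM : k ≤ M) (hM : M ≤ n)
    (Q : Finset (Perm (Fin n)))
    (hQ : ∀ σ ∈ Q, ∀ π : Perm (Fin n), (∀ i : Fin n, M ≤ (i : ℕ) → π i = i) → σ * π ∈ Q) :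
    M.choose l * #{σ ∈ Q | ∀ j : Fin n, k ≤ (j : ℕ) → (j : ℕ) < M → l ≤ lowerCount σ k j} =
      k.choose l * #Q := by
  have key := card_mul_card_filter_mem Q (fun σ => lowest σ M l)
    (powersetCard l ({i : Fin n | (i : ℕ) < M} : Finset (Fin n)))
    (fun σ _ => mem_powersetCard.2 ⟨fun i hi => by
      simp only [lowest, mem_filter, mem_univ, true_and] at hi ⊢
      exact hi.1, card_lowest σ (hlk.trans hkM) hM⟩)
    -- Right multiplication acts on positions, so a `π` carrying `T` to `S` and fixing all positions
    -- from `M` on turns the lowest set `S` into `T`.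
    (fun S hS T hT => by
      rw [mem_powersetCard] at hS hT
      obtain ⟨π, h1, h2⟩ := exists_perm_mem_iff hS.1 hT.1 (hS.2.trans hT.2.symm)
      have h3 : ∀ i : Fin n, M ≤ (i : ℕ) → π i = i := fun i hi => h1 i (by simp; omega)
      refine ⟨π, fun σ hσ hx => ⟨hQ σ hσ π h3, ?_⟩⟩
      ext i
      rw [mem_lowest_mul l σ h3, ← h2, ← hx])
    (U := powersetCard l ({i : Fin n | (i : ℕ) < k} : Finset (Fin n)))
    (powersetCard_mono fun i hi => by
      simp only [mem_filter, mem_univ, true_and] at hi ⊢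
      omega)
  rw [card_powersetCard, card_powersetCard, card_filter_val_lt hM,
    card_filter_val_lt (hkM.trans hM)] at key
  rw [← key]
  congr 2
  refine filter_congr fun σ _ => ?_
  rw [forall_le_lowerCount_iff σ (hlk.trans hkM) hkM hM, mem_powersetCard]
  simp only [card_lowest σ (hlk.trans hkM) hM, and_true]

theorem card_filter_apply_eq {n : ℕ} (m v : Fin n) :
    n * #{σ : Perm (Fin n) | σ m = v} = n.factorial := by
  have key := card_mul_card_filter_mem (univ : Finset (Perm (Fin n))) (fun σ => σ.symm v) univ
    (fun _ _ => mem_univ _)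
    (fun x _ y _ => ⟨swap x y, fun σ _ hx => ⟨mem_univ _, by
      rw [symm_apply_eq] at hx ⊢
      simp [hx]⟩⟩) (subset_univ {m})
  simp only [mem_singleton, card_singleton, card_univ, Fintype.card_fin, Fintype.card_perm,
    one_mul] at key
  rw [← key]
  congr 2
  refine filter_congr fun σ _ => ?_
  rw [symm_apply_eq]
  exact eq_comm

/-- Once `v` sits at `m`, the position of `w` is uniform on the other `n - 1` positions, since
transpositions avoiding `m` permute these. -/
theorem card_filter_apply_eq_symm_mem {n : ℕ} {m v w : Fin n} (hvw : w ≠ v) {U : Finset (Fin n)}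
    (hU : m ∉ U) :
    (n - 1) * #{σ : Perm (Fin n) | σ m = v ∧ σ.symm w ∈ U} =
      #U * #{σ : Perm (Fin n) | σ m = v} := by
  have key := card_mul_card_filter_mem ({σ : Perm (Fin n) | σ m = v} : Finset (Perm (Fin n)))
    (fun σ => σ.symm w) (univ.erase m)
    (fun σ hσ => by
      simp only [mem_filter, mem_univ, true_and] at hσ
      rw [mem_erase]
      refine ⟨fun h => hvw ?_, mem_univ _⟩
      rw [symm_apply_eq] at h
      rw [h, hσ])
    (fun x hx y hy => ⟨swap x y, fun σ hσ hσx => by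
      simp only [mem_filter, mem_univ, true_and] at hσ ⊢
      rw [mem_erase] at hx hy
      rw [symm_apply_eq] at hσx ⊢
      constructor
      · rw [Perm.mul_apply, swap_apply_of_ne_of_ne hx.1.symm hy.1.symm, hσ]
      · simp [hσx]⟩)
    (U := U) (fun i hi => mem_erase.2 ⟨fun h => hU (h ▸ hi), mem_univ _⟩)
  rw [card_erase_of_mem (mem_univ _), card_univ, Fintype.card_fin, filter_filter] at key
  exact key

/-! ### Exact probabilities and expected rewards -/

theorem expectedReward_eq_sum {n : ℕ} (d : ℕ) {k l : ℕ} (hkn : k < n) :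
    expectedReward n d k l = ∑ v ∈ range d, ((n : ℝ) - v) *
      ((#{σ : Perm (Fin n) | selected σ k l = v + 1} : ℝ) / n.factorial) := by
  have hreward : ∀ σ : Perm (Fin n), reward n d (selected σ k l) =
      ∑ v ∈ range d, if selected σ k l = v + 1 then (n : ℝ) - v else 0 := by
    intro σ
    obtain ⟨s, hs⟩ : ∃ s, selected σ k l = s + 1 := ⟨selected σ k l - 1, by
      have := one_le_selected σ (l := l) hkn
      omega⟩
    simp only [hs, add_left_inj, sum_ite_eq, mem_range, reward, Nat.succ_le_iff]
    push_cast
    congr 1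
    ring
  rw [expectedReward, sum_congr rfl fun σ _ => hreward σ, sum_comm, sum_div]
  refine sum_congr rfl fun v _ => ?_
  rw [← sum_filter, sum_const, nsmul_eq_mul]
  ring

theorem card_selected_eq_sum {n : ℕ} {k l : ℕ} (hl : 1 ≤ l) (hlk : l ≤ k) (hkn : k < n)
    (v : Fin n) :
    #{σ : Perm (Fin n) | selected σ k l = v + 1} = ∑ m : Fin n, if k ≤ (m : ℕ) then
      #{σ : Perm (Fin n) | σ m = v ∧ (∀ j : Fin n, k ≤ (j : ℕ) → j < m → l ≤ lowerCount σ k j) ∧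
        (lowerCount σ k m < l ∨ (m : ℕ) = n - 1)} else 0 := by
  have hmaps : Set.MapsTo (fun σ : Perm (Fin n) => σ.symm v)
      ({σ : Perm (Fin n) | selected σ k l = v + 1} : Finset (Perm (Fin n)))
      (univ : Finset (Fin n)) := fun _ _ => by simp
  rw [card_eq_sum_card_fiberwise hmaps]
  refine sum_congr rfl fun m _ => ?_
  rw [filter_filter]
  split_ifs with hm
  · congr 1
    refine filter_congr fun σ _ => ?_
    rw [selected_eq_iff σ hl hlk hkn]
    constructor
    · rintro ⟨⟨-, h⟩, rfl⟩
      exact ⟨by simp, h⟩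
    · rintro ⟨rfl, h⟩
      simpa using ⟨hm, h⟩
  · rw [card_eq_zero, filter_eq_empty_iff]
    rintro σ - ⟨h, rfl⟩
    exact hm ((selected_eq_iff σ hl hlk hkn v).1 h).1

theorem sum_fin_ite_le {n k : ℕ} (g : ℕ → ℝ) :
    (∑ m : Fin n, if k ≤ (m : ℕ) then g m else 0) = ∑ m ∈ Ico k n, g m := by
  rw [Fin.sum_univ_eq_sum_range (fun m => if k ≤ m then g m else 0), ← sum_filter]
  refine sum_congr ?_ fun _ _ => rfl
  ext m
  simp only [mem_filter, mem_range, mem_Ico]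
  tauto

/-- Since `v < l`, the value beats the test value wherever it stands after the first `k` terms. It
stands at `m` with probability `1/n`, and then no earlier term is chosen with probability `C(k,l) /
C(m,l)`. -/
theorem prob_selected_of_lt {n k l : ℕ} (hl : 1 ≤ l) (hlk : l ≤ k) (hkn : k < n) {v : ℕ}
    (hv : v < l) :
    (#{σ : Perm (Fin n) | selected σ k l = v + 1} : ℝ) / n.factorial =
      (∑ m ∈ Ico k n, (k.choose l : ℝ) / m.choose l) / n := by
  have hn : (n : ℝ) ≠ 0 := by exact_mod_cast (by omega : n ≠ 0)
  have hfac : (n.factorial : ℝ) ≠ 0 := by exact_mod_cast n.factorial_ne_zero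
  have h := card_selected_eq_sum hl hlk hkn ⟨v, by omega⟩
  simp only at h
  rw [h, Nat.cast_sum, sum_div, sum_div, ← sum_fin_ite_le]
  refine sum_congr rfl fun m _ => ?_
  split_ifs with hm
  · have hset : ({σ : Perm (Fin n) | σ m = ⟨v, by omega⟩ ∧
        (∀ j : Fin n, k ≤ (j : ℕ) → j < m → l ≤ lowerCount σ k j) ∧
        (lowerCount σ k m < l ∨ (m : ℕ) = n - 1)} : Finset (Perm (Fin n))) =
      {σ ∈ ({σ : Perm (Fin n) | σ m = ⟨v, by omega⟩} : Finset (Perm (Fin n))) |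
        ∀ j : Fin n, k ≤ (j : ℕ) → (j : ℕ) < m → l ≤ lowerCount σ k j} := by
      rw [filter_filter]
      refine filter_congr fun σ _ => ?_
      constructor
      · exact fun h => ⟨h.1, h.2.1⟩
      · refine fun h => ⟨h.1, h.2, Or.inl ?_⟩
        have := lowerCount_le_val σ k m
        rw [h.1] at this
        exact this.trans_lt hv
    have h1 := choose_mul_card_filter hlk hm m.isLt.le
      ({σ : Perm (Fin n) | σ m = ⟨v, by omega⟩} : Finset (Perm (Fin n)))
      (fun σ hσ π hπ => by
        simp only [mem_filter, mem_univ, true_and] at hσ ⊢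
        rw [Perm.mul_apply, hπ m le_rfl, hσ])
    have h2 := card_filter_apply_eq m ⟨v, by omega⟩
    rw [hset]
    have h1' := congrArg (Nat.cast (R := ℝ)) h1
    have h2' := congrArg (Nat.cast (R := ℝ)) h2
    push_cast at h1' h2'
    have hc : ((m : ℕ).choose l : ℝ) ≠ 0 := by
      exact_mod_cast (Nat.choose_pos (hlk.trans hm)).ne'
    rw [div_div, div_eq_div_iff hfac (mul_ne_zero hc hn), ← h2']
    linear_combination (n : ℝ) * h1'
  · simp

/-- Let value 2 stand at `m`. If value 1 is after `m`, value 2 beats the test value and only an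
earlier choice can prevent its selection, which gives the factor `k/m`. If value 1 is in `[k, m)`,
the rule stops before `m`. If value 1 is among the first `k`, nothing beats it and value 2 is
selected only by default, at `m = n - 1`; this is the extra `k / (n - 1)`. -/
theorem prob_selected_two {n k : ℕ} (hk : 1 ≤ k) (hkn : k < n) :
    (#{σ : Perm (Fin n) | selected σ k 1 = 2} : ℝ) / n.factorial =
      (∑ m ∈ Ico k n, (k : ℝ) / m * ((n - 1 - m) / (n - 1)) + k / (n - 1)) / n := by
  have hn : (n : ℝ) ≠ 0 := by exact_mod_cast (by omega : n ≠ 0)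
  have hn1 : (n : ℝ) - 1 ≠ 0 := by
    have : (1 : ℝ) < n := by exact_mod_cast (by omega : 1 < n)
    linarith
  have hfac : (n.factorial : ℝ) ≠ 0 := by exact_mod_cast n.factorial_ne_zero
  let v : Fin n := ⟨1, by omega⟩
  let w : Fin n := ⟨0, by omega⟩
  have hvw : w ≠ v := by simp [v, w]
  have h := card_selected_eq_sum le_rfl hk hkn v
  have hsum : ∑ m ∈ Ico k n, (k : ℝ) / m * ((n - 1 - m) / (n - 1)) + k / (n - 1) =
      ∑ m ∈ Ico k n, ((k : ℝ) / m * ((n - 1 - m) / (n - 1)) +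
        if m = n - 1 then (k : ℝ) / (n - 1) else 0) := by
    rw [sum_add_distrib, sum_ite_eq', if_pos (mem_Ico.2 ⟨by omega, by omega⟩)]
  change (#{σ : Perm (Fin n) | selected σ k 1 = (v : ℕ) + 1} : ℝ) / n.factorial = _
  rw [hsum, h, Nat.cast_sum, sum_div, sum_div, ← sum_fin_ite_le]
  refine sum_congr rfl fun m _ => ?_
  have hmlt := m.isLt
  have h2' := congrArg (Nat.cast (R := ℝ)) (card_filter_apply_eq m v)
  push_cast at h2'
  have hw : ∀ σ : Perm (Fin n), ∀ i, σ i < v ↔ i = σ.symm w := by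
    intro σ i
    rw [eq_symm_apply, Fin.ext_iff, Fin.lt_def]
    simp [v, w]
  have hw0 : ∀ σ : Perm (Fin n), lowerCount σ k (σ.symm w) = 0 := by
    intro σ
    have := lowerCount_le_val σ k (σ.symm w)
    simpa [w] using this
  have hw1 : ∀ σ : Perm (Fin n), (σ.symm w : ℕ) < k → ∀ j : Fin n, k ≤ (j : ℕ) →
      1 ≤ lowerCount σ k j := by
    intro σ hσ j hj
    refine card_pos.2 ⟨σ.symm w, ?_⟩
    simp only [mem_filter, mem_univ, true_and, apply_symm_apply]
    refine ⟨hσ, ?_⟩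
    have : σ j ≠ w := by
      rintro h
      rw [← h, symm_apply_apply] at hσ
      omega
    rw [Ne, Fin.ext_iff] at this
    rw [Fin.lt_def]
    simp only [w] at this ⊢
    omega
  have hwm : ∀ σ : Perm (Fin n), σ m = v → σ.symm w ≠ m := by
    rintro σ hσ h
    rw [symm_apply_eq, hσ] at h
    exact hvw h
  split_ifs with hm hlast
  · have hset : ({σ : Perm (Fin n) | σ m = v ∧
        (∀ j : Fin n, k ≤ (j : ℕ) → j < m → 1 ≤ lowerCount σ k j) ∧
        (lowerCount σ k m < 1 ∨ (m : ℕ) = n - 1)} : Finset (Perm (Fin n))) =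
      ({σ : Perm (Fin n) | σ m = v ∧
        σ.symm w ∈ ({i : Fin n | (i : ℕ) < k} : Finset (Fin n))} : Finset (Perm (Fin n))) := by
      refine filter_congr fun σ _ => ?_
      rw [mem_filter]
      constructor
      · rintro ⟨h1, h3, -⟩
        refine ⟨h1, mem_univ _, ?_⟩
        by_contra hcon
        have h4 := h3 (σ.symm w) (by omega) (lt_of_le_of_ne (Fin.le_def.2 (by omega)) (hwm σ h1))
        rw [hw0] at h4
        omega
      · rintro ⟨h1, -, h3⟩
        exact ⟨h1, fun j hj _ => hw1 σ h3 j hj, Or.inr hlast⟩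
    have h1 := card_filter_apply_eq_symm_mem hvw (m := m)
      (U := ({i : Fin n | (i : ℕ) < k} : Finset (Fin n))) (by simpa using hm)
    rw [card_filter_val_lt hkn.le] at h1
    have h1' := congrArg (Nat.cast (R := ℝ)) h1
    push_cast [Nat.cast_sub (by omega : 1 ≤ n)] at h1'
    rw [hset]
    have : ((m : ℕ) : ℝ) = n - 1 := by rw [hlast, Nat.cast_sub (by omega)]; simp
    rw [this, sub_self, zero_div, mul_zero, zero_add, div_div,
      div_eq_div_iff hfac (mul_ne_zero hn1 hn), ← h2']
    linear_combination (n : ℝ) * h1'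
  · have hset : ({σ : Perm (Fin n) | σ m = v ∧
        (∀ j : Fin n, k ≤ (j : ℕ) → j < m → 1 ≤ lowerCount σ k j) ∧
        (lowerCount σ k m < 1 ∨ (m : ℕ) = n - 1)} : Finset (Perm (Fin n))) =
      {σ ∈ ({σ : Perm (Fin n) | σ m = v ∧ σ.symm w ∈ Ioi m} : Finset (Perm (Fin n))) |
        ∀ j : Fin n, k ≤ (j : ℕ) → (j : ℕ) < m → 1 ≤ lowerCount σ k j} := by
      rw [filter_filter]
      refine filter_congr fun σ _ => ?_
      rw [mem_Ioi]
      constructor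
      · rintro ⟨h1, h3, h4⟩
        refine ⟨⟨h1, ?_⟩, h3⟩
        have h5 := h4.resolve_right hlast
        by_contra hcon
        have hlt := lt_of_le_of_ne (not_lt.1 hcon) (hwm σ h1)
        by_cases hwk : (σ.symm w : ℕ) < k
        · have := hw1 σ hwk m hm
          omega
        · have := h3 _ (not_lt.1 hwk) hlt
          rw [hw0] at this
          omega
      · rintro ⟨⟨h1, h3⟩, h4⟩
        refine ⟨h1, h4, Or.inl ?_⟩
        rw [Nat.lt_one_iff, lowerCount, card_eq_zero, filter_eq_empty_iff]
        rintro i - ⟨hi, hσi⟩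
        rw [h1, hw] at hσi
        rw [Fin.lt_def, ← hσi] at h3
        omega
    have h1 := card_filter_apply_eq_symm_mem hvw (m := m) (U := Ioi m) (by simp)
    rw [Fin.card_Ioi] at h1
    -- Both prescribed values stand at or after `m`, so rearranging the terms before `m` preserves
    -- the family.
    have h3 := choose_mul_card_filter hk hm hmlt.le
      ({σ : Perm (Fin n) | σ m = v ∧ σ.symm w ∈ Ioi m} : Finset (Perm (Fin n)))
      (fun σ hσ π hπ => by
        simp only [mem_filter, mem_univ, true_and, mem_Ioi] at hσ ⊢
        refine ⟨by rw [Perm.mul_apply, hπ m le_rfl, hσ.1], ?_⟩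
        have : (σ * π).symm w = σ.symm w := by
          rw [symm_apply_eq, Perm.mul_apply, hπ _ (Fin.lt_def.1 hσ.2).le, apply_symm_apply]
        rw [this]
        exact hσ.2)
    rw [Nat.choose_one_right, Nat.choose_one_right] at h3
    have h1' := congrArg (Nat.cast (R := ℝ)) h1
    have h3' := congrArg (Nat.cast (R := ℝ)) h3
    push_cast [Nat.cast_sub (by omega : 1 ≤ n), Nat.cast_sub (by omega : (m : ℕ) ≤ n - 1)]
      at h1' h3'
    rw [hset]
    have hm0 : ((m : ℕ) : ℝ) ≠ 0 := by exact_mod_cast (by omega : (m : ℕ) ≠ 0)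
    rw [add_zero, div_mul_div_comm, div_div,
      div_eq_div_iff hfac (mul_ne_zero (mul_ne_zero hm0 hn1) hn), ← h2']
    linear_combination (n : ℝ) * (n - 1) * h3' + (n : ℝ) * k * h1'
  · simp

theorem expectedReward_one {n k : ℕ} (hk : 1 ≤ k) (hkn : k < n) :
    expectedReward n 1 k 1 = k * ∑ m ∈ Ico k n, (1 : ℝ) / m := by
  have hn : (n : ℝ) ≠ 0 := by exact_mod_cast (by omega : n ≠ 0)
  rw [expectedReward_eq_sum 1 hkn, sum_range_one, prob_selected_of_lt le_rfl hk hkn one_pos]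
  simp only [Nat.choose_one_right, Nat.cast_zero, sub_zero, mul_sum, mul_one_div]
  rw [mul_div_cancel₀ _ hn]

theorem expectedReward_two_one {n k : ℕ} (hk : 1 ≤ k) (hkn : k < n) :
    expectedReward n 2 k 1 = k * (∑ m ∈ Ico k n, (1 : ℝ) / m) +
      k * ((n - 1) * (∑ m ∈ Ico k n, (1 : ℝ) / m) - (n - k) + 1) / n := by
  have hn : (n : ℝ) ≠ 0 := by exact_mod_cast (by omega : n ≠ 0)
  have hn1 : (n : ℝ) - 1 ≠ 0 := by
    have : (1 : ℝ) < n := by exact_mod_cast (by omega : 1 < n)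
    linarith
  have hsum : ∑ m ∈ Ico k n, (k : ℝ) / m * ((n - 1 - m) / (n - 1)) =
      k / (n - 1) * ((n - 1) * (∑ m ∈ Ico k n, (1 : ℝ) / m) - (n - k)) := by
    have hcard : (n : ℝ) - k = ∑ m ∈ Ico k n, (1 : ℝ) := by
      rw [sum_const, Nat.card_Ico, nsmul_eq_mul, Nat.cast_sub hkn.le, mul_one]
    rw [hcard, mul_sum, ← sum_sub_distrib, mul_sum]
    refine sum_congr rfl fun m hm => ?_
    have : (m : ℝ) ≠ 0 := by
      have := (mem_Ico.1 hm).1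
      exact_mod_cast (by omega : m ≠ 0)
    field_simp
  rw [expectedReward_eq_sum 2 hkn, sum_range_succ, sum_range_one,
    prob_selected_of_lt le_rfl hk hkn one_pos]
  norm_num only
  rw [prob_selected_two hk hkn, hsum]
  simp only [Nat.choose_one_right]
  have : ∑ m ∈ Ico k n, (k : ℝ) / m = k * ∑ m ∈ Ico k n, (1 : ℝ) / m := by
    rw [mul_sum]
    simp only [mul_one_div]
  rw [this]
  field_simp
  ring

/-- The sum telescopes, because `1 / C(m,2) = 2 (1/(m-1) - 1/m)`. -/
theorem sum_choose_two_div {k n : ℕ} (hk : 2 ≤ k) (hkn : k ≤ n) :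
    ∑ m ∈ Ico k n, (k.choose 2 : ℝ) / m.choose 2 = k * (n - k) / (n - 1) := by
  induction n, hkn using Nat.le_induction with
  | base => simp
  | succ n hkn ih =>
    have : (2 : ℝ) ≤ n := by exact_mod_cast hk.trans hkn
    have h1 : (n : ℝ) - 1 ≠ 0 := by linarith
    have h2 : (n : ℝ) ≠ 0 := by linarith
    rw [sum_Ico_succ_top hkn, ih, Nat.cast_choose_two, Nat.cast_choose_two]
    push_cast
    rw [add_sub_cancel_right]
    field_simp
    ring

theorem expectedReward_two_two {n k : ℕ} (hk : 2 ≤ k) (hkn : k < n) :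
    expectedReward n 2 k 2 = (2 * n - 1) / n * (k * (n - k) / (n - 1)) := by
  have hn : (n : ℝ) ≠ 0 := by exact_mod_cast (by omega : n ≠ 0)
  rw [expectedReward_eq_sum 2 hkn, sum_range_succ, sum_range_one,
    prob_selected_of_lt one_le_two hk hkn two_pos, prob_selected_of_lt one_le_two hk hkn one_lt_two,
    sum_choose_two_div hk hkn.le]
  push_cast
  field_simp
  ring

/-! ### Approximation by functions of `k / n`, uniformly in `k` -/

/-- Each step uses `1/(n+1) ≤ log(n+1) - log n ≤ 1/n`. The term `-1/n` in the upper bound makes the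
induction close. -/
theorem sum_one_div_bounds {k n : ℕ} (hk : 1 ≤ k) (hkn : k ≤ n) :
    Real.log n - Real.log k ≤ ∑ m ∈ Ico k n, (1 : ℝ) / m ∧
      ∑ m ∈ Ico k n, (1 : ℝ) / m ≤ Real.log n - Real.log k + 1 / k - 1 / n := by
  induction n, hkn using Nat.le_induction with
  | base => simp
  | succ n hkn ih =>
    have hn : (0 : ℝ) < n := by exact_mod_cast hk.trans hkn
    have hn1 : (0 : ℝ) < n + 1 := by linarith
    have hlog : Real.log ((n + 1) / n) = Real.log (n + 1) - Real.log n :=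
      Real.log_div hn1.ne' hn.ne'
    have h1 := Real.log_le_sub_one_of_pos (div_pos hn1 hn)
    have h2 := Real.one_sub_inv_le_log_of_pos (div_pos hn1 hn)
    rw [hlog] at h1 h2
    have h3 : ((n : ℝ) + 1) / n - 1 = 1 / n := by field_simp; ring
    have h4 : 1 - (((n : ℝ) + 1) / n)⁻¹ = 1 / (n + 1) := by field_simp; ring
    rw [h3] at h1
    rw [h4] at h2
    rw [sum_Ico_succ_top hkn]
    push_cast
    exact ⟨by linarith, by linarith⟩

theorem mul_sum_div_bounds {k n : ℕ} (hk : 1 ≤ k) (hkn : k < n) :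
    Real.negMulLog (k / n) ≤ k * (∑ m ∈ Ico k n, (1 : ℝ) / m) / n ∧
      k * (∑ m ∈ Ico k n, (1 : ℝ) / m) / n ≤ Real.negMulLog (k / n) + 1 / n := by
  have hk0 : (0 : ℝ) < k := by exact_mod_cast hk
  have hn0 : (0 : ℝ) < n := by exact_mod_cast (by omega : 0 < n)
  obtain ⟨h1, h2⟩ := sum_one_div_bounds hk hkn.le
  have h3 : (0 : ℝ) ≤ 1 / n := by positivity
  have h4 : Real.negMulLog (k / n) = k * (Real.log n - Real.log k) / n := by
    rw [Real.negMulLog, Real.log_div hk0.ne' hn0.ne']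
    ring
  have h5 : k * (Real.log n - Real.log k) / n + 1 / n =
      k * (Real.log n - Real.log k + 1 / k) / (n : ℝ) := by
    field_simp
  rw [h4, h5]
  exact ⟨by gcongr, by gcongr; linarith⟩

theorem mul_sum_one_div_le {k n : ℕ} (hk : 1 ≤ k) (hkn : k ≤ n) :
    k * (∑ m ∈ Ico k n, (1 : ℝ) / m) ≤ n := by
  have hk0 : (0 : ℝ) < k := by exact_mod_cast hk
  calc k * (∑ m ∈ Ico k n, (1 : ℝ) / m) ≤ k * ∑ m ∈ Ico k n, (1 : ℝ) / k := by
        gcongr with m hm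
        exact (mem_Ico.1 hm).1
    _ = n - k := by
        rw [sum_const, Nat.card_Ico, nsmul_eq_mul, Nat.cast_sub hkn]
        field_simp
    _ ≤ n := by linarith

theorem abs_expectedReward_one_le {k n : ℕ} (hk : 1 ≤ k) (hkn : k < n) :
    |expectedReward n 1 k 1 / n - Real.negMulLog (k / n)| ≤ 1 / n := by
  obtain ⟨h1, h2⟩ := mul_sum_div_bounds hk hkn
  rw [expectedReward_one hk hkn, abs_le]
  have : (0 : ℝ) ≤ 1 / n := by positivity
  exact ⟨by linarith, by linarith⟩

theorem abs_expectedReward_two_one_le {k n : ℕ} (hk : 1 ≤ k) (hkn : k < n) :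
    |expectedReward n 2 k 1 / n -
      (2 * Real.negMulLog (k / n) - k / n * (1 - k / n))| ≤ 3 / n := by
  have hk0 : (0 : ℝ) < k := by exact_mod_cast hk
  have hn0 : (0 : ℝ) < n := by exact_mod_cast (by omega : 0 < n)
  have hkn' : (k : ℝ) ≤ n := by exact_mod_cast hkn.le
  obtain ⟨h1, h2⟩ := mul_sum_div_bounds hk hkn
  have h3 := mul_sum_one_div_le hk hkn.le
  rw [expectedReward_two_one hk hkn]
  have hS : 0 ≤ ∑ m ∈ Ico k n, (1 : ℝ) / m := sum_nonneg fun _ _ => by positivity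
  set S := ∑ m ∈ Ico k n, (1 : ℝ) / m
  -- The error `3/n` splits into `2/n` from the two copies of `k * S / n` and `1/n` from the
  -- lower-order terms, which have opposite signs.
  have h4 : (k * S + k * ((n - 1) * S - (n - k) + 1) / n) / n =
      2 * (k * S / n) - k * S / n * (1 / n) - k / n * (1 - k / n) + k / n * (1 / n) := by
    field_simp
    ring
  have h5 : k * S / n * (1 / n) ≤ 1 * (1 / n) := by
    gcongr
    rwa [div_le_one hn0]
  have h6 : (k : ℝ) / n * (1 / n) ≤ 1 * (1 / n) := by
    gcongr
    rwa [div_le_one hn0]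
  have h7 : 0 ≤ k * S / n * (1 / n) := by positivity
  have h8 : 0 ≤ (k : ℝ) / n * (1 / n) := by positivity
  have h9 : (0 : ℝ) ≤ 1 / n := by positivity
  have h10 : (3 : ℝ) / n = 3 * (1 / n) := by ring
  rw [h4, h10, abs_le]
  exact ⟨by linarith, by linarith⟩

theorem abs_expectedReward_two_two_le {k n : ℕ} (hk : 2 ≤ k) (hkn : k < n) :
    |expectedReward n 2 k 2 / n - 2 * (k / n * (1 - k / n))| ≤ 1 / n := by
  have hk0 : (2 : ℝ) ≤ k := by exact_mod_cast hk
  have hkn' : (k : ℝ) + 1 ≤ n := by exact_mod_cast hkn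
  have hn0 : (0 : ℝ) < n := by linarith
  have hn1 : (0 : ℝ) < n - 1 := by linarith
  have h : expectedReward n 2 k 2 / n - 2 * (k / n * (1 - k / n)) =
      k / n * ((n - k) / (n - 1)) * (1 / n) := by
    rw [expectedReward_two_two hk hkn]
    field_simp
    ring
  have h1 : (k : ℝ) / n ≤ 1 := (div_le_one hn0).2 (by linarith)
  have h2 : ((n : ℝ) - k) / (n - 1) ≤ 1 := (div_le_one hn1).2 (by linarith)
  have h3 : 0 ≤ ((n : ℝ) - k) / (n - 1) := div_nonneg (by linarith) hn1.le
  have h4 : (0 : ℝ) ≤ 1 / n := by positivity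
  rw [h, abs_of_nonneg (by positivity)]
  calc (k : ℝ) / n * ((n - k) / (n - 1)) * (1 / n) ≤ 1 * 1 * (1 / n) := by gcongr
    _ = 1 / n := by ring

/-- If `V_{n,d}(k,l) / n` is uniformly close to `f (k / n)`, then its maximum over `k` tends to the
maximum of `f`. -/
theorem tendsto_maxRewardAt_div {d l : ℕ} (hl : 1 ≤ l) {f : ℝ → ℝ} {x C : ℝ} (hx0 : 0 < x)
    (hx1 : x < 1) (hf : ContinuousAt f x) (hmax : ∀ t, 0 < t → t < 1 → f t ≤ f x)
    (happrox : ∀ n k : ℕ, l ≤ k → k < n → |expectedReward n d k l / n - f (k / n)| ≤ C / n) :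
    Tendsto (fun n : ℕ => maxRewardAt n d l / (n : ℝ)) atTop (𝓝 (f x)) := by
  have hC : Tendsto (fun n : ℕ => C / (n : ℝ)) atTop (𝓝 0) :=
    tendsto_const_div_atTop_nhds_zero_nat C
  -- The choice `k = ⌊x * n⌋₊` supplies the lower bound for the maximum; the upper bound applies
  -- `hmax` at a maximizing `k`.
  have hfloor : Tendsto (fun n : ℕ => ((⌊x * n⌋₊ : ℕ) : ℝ) / n) atTop (𝓝 x) :=
    (tendsto_nat_floor_mul_div_atTop hx0.le).comp tendsto_natCast_atTop_atTop
  have hlow : Tendsto (fun n : ℕ => f (((⌊x * n⌋₊ : ℕ) : ℝ) / n) - C / n) atTop (𝓝 (f x)) := by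
    simpa using (hf.tendsto.comp hfloor).sub hC
  have hupp : Tendsto (fun n : ℕ => f x + C / (n : ℝ)) atTop (𝓝 (f x)) := by
    simpa using hC.const_add (f x)
  have hlarge : ∀ᶠ n : ℕ in atTop, l ≤ ⌊x * (n : ℝ)⌋₊ :=
    (tendsto_nat_floor_atTop.comp
      (tendsto_natCast_atTop_atTop.const_mul_atTop hx0)).eventually_ge_atTop l
  refine tendsto_of_tendsto_of_tendsto_of_le_of_le' hlow hupp ?_ ?_
  · filter_upwards [hlarge, eventually_gt_atTop l] with n hn hln
    have hn0 : (0 : ℝ) < n := by exact_mod_cast (by omega : 0 < n)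
    have hlt : ⌊x * (n : ℝ)⌋₊ < n := by
      rw [Nat.floor_lt (by positivity)]
      nlinarith
    have h1 := (abs_le.1 (happrox n _ hn hlt)).1
    have h2 : expectedReward n d ⌊x * (n : ℝ)⌋₊ l ≤ maxRewardAt n d l :=
      (maxRewardAt_isGreatest hl hln d).2 ⟨_, hl, hn, hlt, rfl⟩
    have h3 := div_le_div_of_nonneg_right h2 hn0.le
    linarith
  · filter_upwards [eventually_gt_atTop l] with n hln
    have hn0 : (0 : ℝ) < n := by exact_mod_cast (by omega : 0 < n)
    obtain ⟨k, -, hlk, hkn, hk⟩ := (maxRewardAt_isGreatest hl hln d).1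
    have hk0 : (0 : ℝ) < k := by exact_mod_cast (by omega : 0 < k)
    have h1 := (abs_le.1 (happrox n k hlk hkn)).2
    have h2 := hmax (k / n) (by positivity) ((div_lt_one hn0).2 (by exact_mod_cast hkn))
    rw [hk]
    linarith

/-! ### Maxima of the limit functions and the roots of `2z - 2 log z = 3` -/

theorem negMulLog_le_one_div_exp {t : ℝ} (ht : 0 < t) : Real.negMulLog t ≤ 1 / Real.exp 1 := by
  have he := Real.exp_pos 1
  have h := Real.log_le_sub_one_of_pos (show 0 < 1 / (Real.exp 1 * t) by positivity)
  rw [one_div, Real.log_inv, Real.log_mul he.ne' ht.ne', Real.log_exp] at h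
  have h2 := mul_le_mul_of_nonneg_left (show -Real.log t ≤ (Real.exp 1 * t)⁻¹ by linarith) ht.le
  have h3 : t * (Real.exp 1 * t)⁻¹ = 1 / Real.exp 1 := by field_simp
  rw [Real.negMulLog]
  linarith

theorem negMulLog_one_div_exp : Real.negMulLog (1 / Real.exp 1) = 1 / Real.exp 1 := by
  rw [Real.negMulLog, one_div, Real.log_inv, Real.log_exp]
  ring

/-- Follows from `log (a/b) < a/b - 1`. This monotonicity serves both to count the roots and to find
the sign of the derivative around `x`. -/
theorem sub_log_lt_of_lt {a b : ℝ} (ha : 0 < a) (hab : a < b) (hb : b ≤ 1) :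
    b - Real.log b < a - Real.log a := by
  have hb0 := ha.trans hab
  have h := Real.log_lt_sub_one_of_pos (div_pos ha hb0) (by
    rw [Ne, div_eq_one_iff_eq hb0.ne']
    exact hab.ne)
  rw [Real.log_div ha.ne' hb0.ne'] at h
  have h2 : b - a ≤ 1 - a / b := by
    rw [one_sub_div hb0.ne', le_div_iff₀ hb0]
    nlinarith
  linarith

theorem sub_log_lt_of_one_le {a b : ℝ} (ha : 1 ≤ a) (hab : a < b) :
    a - Real.log a < b - Real.log b := by
  have ha0 : 0 < a := by linarith
  have hb0 := ha0.trans hab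
  have h := Real.log_lt_sub_one_of_pos (div_pos hb0 ha0) (by
    rw [Ne, div_eq_one_iff_eq ha0.ne']
    exact hab.ne')
  rw [Real.log_div hb0.ne' ha0.ne'] at h
  have h2 : b / a - 1 ≤ b - a := by
    rw [div_sub_one ha0.ne', div_le_iff₀ ha0]
    nlinarith
  linarith

theorem continuousOn_sub_log : ContinuousOn (fun z => 2 * z - 2 * Real.log z) (Set.Ioi 0) := by
  refine ContinuousOn.sub (by fun_prop) (continuousOn_const.mul ?_)
  exact Real.continuousOn_log.mono fun z hz => (Set.mem_Ioi.1 hz).ne'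

/-- The equation is equivalent to `z = exp (z - 3/2)`. Multiplying by `e` brings the exponent into
the range `|x| ≤ 1` required by `Real.exp_bound`. -/
theorem lt_exp_neg : (0.301706 : ℝ) < Real.exp (0.301706 - 1.5) := by
  have h := (abs_le.1 (Real.exp_bound (x := -0.198294) (by norm_num [abs_le]) (n := 7)
    (by norm_num))).1
  have he := Real.exp_one_lt_d9
  have hexp : Real.exp (0.301706 - 1.5) * Real.exp 1 = Real.exp (-0.198294) := by
    rw [← Real.exp_add]
    norm_num
  norm_num [Finset.sum_range_succ, Nat.factorial, abs_of_neg] at h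
  by_contra hcon
  have := mul_le_mul_of_nonneg_right (not_lt.1 hcon) (Real.exp_pos 1).le
  norm_num at *
  linarith

theorem exp_neg_lt : Real.exp (0.301712 - 1.5) < (0.301712 : ℝ) := by
  have h := (abs_le.1 (Real.exp_bound (x := -0.198288) (by norm_num [abs_le]) (n := 7)
    (by norm_num))).2
  have he := Real.exp_one_gt_d9
  have hexp : Real.exp (0.301712 - 1.5) * Real.exp 1 = Real.exp (-0.198288) := by
    rw [← Real.exp_add]
    norm_num
  norm_num [Finset.sum_range_succ, Nat.factorial, abs_of_neg] at h
  by_contra hcon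
  have := mul_le_mul_of_nonneg_right (not_lt.1 hcon) (Real.exp_pos 1).le
  norm_num at *
  linarith

/-- The interval is narrower than the accuracy of `x` demands, because it must also give `2x - x²`
to within `5e-6`. -/
theorem exists_small_root :
    ∃ x : ℝ, 0.301706 < x ∧ x < 0.301712 ∧ 2 * x - 2 * Real.log x = 3 := by
  have h1 : (3 : ℝ) < 2 * 0.301706 - 2 * Real.log 0.301706 := by
    have := Real.log_lt_log (by norm_num) lt_exp_neg
    rw [Real.log_exp] at this
    linarith
  have h2 : 2 * (0.301712 : ℝ) - 2 * Real.log 0.301712 < 3 := by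
    have := Real.log_lt_log (Real.exp_pos _) exp_neg_lt
    rw [Real.log_exp] at this
    linarith
  obtain ⟨x, hx, hx3⟩ := intermediate_value_Ioo' (show (0.301706 : ℝ) ≤ 0.301712 by norm_num)
    (continuousOn_sub_log.mono fun z hz => Set.mem_Ioi.2 (lt_of_lt_of_le (by norm_num) hz.1))
    ⟨h2, h1⟩
  exact ⟨x, hx.1, hx.2, hx3⟩

theorem exists_large_root : ∃ y : ℝ, 1 < y ∧ 2 * y - 2 * Real.log y = 3 := by
  have h4 : Real.log 4 = 2 * Real.log 2 := by
    rw [show (4 : ℝ) = 2 ^ 2 by norm_num, Real.log_pow]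
    norm_num
  have h2 := Real.log_two_lt_d9
  obtain ⟨y, hy, hy3⟩ := intermediate_value_Ioo (show (1 : ℝ) ≤ 4 by norm_num)
    (continuousOn_sub_log.mono fun z hz => Set.mem_Ioi.2 (lt_of_lt_of_le (by norm_num) hz.1))
    -- The endpoint 4 has value `8 - 4 log 2 > 3`, and the endpoint 1 has value 2.
    (show (3 : ℝ) ∈ Set.Ioo (2 * 1 - 2 * Real.log 1) (2 * 4 - 2 * Real.log 4) by
      rw [Real.log_one, h4]
      norm_num at *
      linarith)
  exact ⟨y, hy.1, hy3⟩

theorem setOf_root_eq {x y : ℝ} (hx0 : 0 < x) (hx1 : x < 1) (hy1 : 1 < y)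
    (hx : 2 * x - 2 * Real.log x = 3) (hy : 2 * y - 2 * Real.log y = 3) :
    {z : ℝ | 0 < z ∧ 2 * z - 2 * Real.log z = 3} = {x, y} := by
  ext z
  simp only [Set.mem_ofPred_eq, Set.mem_insert_iff, Set.mem_singleton_iff]
  constructor
  · rintro ⟨hz0, hz⟩
    rcases le_total z 1 with h | h
    · left
      rcases lt_trichotomy z x with h' | h' | h'
      · linarith [sub_log_lt_of_lt hz0 h' hx1.le]
      · exact h'
      · linarith [sub_log_lt_of_lt hx0 h' h]
    · right
      rcases lt_trichotomy z y with h' | h' | h'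
      · linarith [sub_log_lt_of_one_le h h']
      · exact h'
      · linarith [sub_log_lt_of_one_le hy1.le h']
  · rintro (rfl | rfl)
    · exact ⟨hx0, hx⟩
    · exact ⟨by linarith, hy⟩

theorem two_negMulLog_sub_eq {x : ℝ} (hx : 2 * x - 2 * Real.log x = 3) :
    2 * Real.negMulLog x - x * (1 - x) = 2 * x - x ^ 2 := by
  rw [Real.negMulLog]
  linear_combination x * hx

/-- The derivative `2c - 2 log c - 3` vanishes at `x` and decreases on `(0, 1]`, so it is positive
before `x` and negative after it; the mean value theorem concludes. -/
theorem two_negMulLog_sub_le {x t : ℝ} (hx0 : 0 < x) (hx1 : x < 1)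
    (hx : 2 * x - 2 * Real.log x = 3) (ht0 : 0 < t) (ht1 : t < 1) :
    2 * Real.negMulLog t - t * (1 - t) ≤ 2 * Real.negMulLog x - x * (1 - x) := by
  have hderiv : ∀ c : ℝ, 0 < c → HasDerivAt (fun t => 2 * Real.negMulLog t - t * (1 - t))
      (2 * c - 2 * Real.log c - 3) c := by
    intro c hc
    have h1 := (Real.hasDerivAt_negMulLog hc.ne').const_mul 2
    have h2 := (hasDerivAt_id' c).fun_mul ((hasDerivAt_id' c).const_sub 1)
    refine (h1.fun_sub h2).congr_deriv ?_
    ring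
  have hcont : ∀ a b : ℝ, 0 < a → ContinuousOn (fun t => 2 * Real.negMulLog t - t * (1 - t))
      (Set.Icc a b) := fun a b ha z hz =>
    (hderiv z (ha.trans_le hz.1)).continuousAt.continuousWithinAt
  rcases lt_trichotomy t x with h | h | h
  · obtain ⟨c, hc, hslope⟩ := exists_hasDerivAt_eq_slope _ _ h (hcont t x ht0)
      (fun z hz => hderiv z (ht0.trans hz.1))
    have hpos := sub_log_lt_of_lt (ht0.trans hc.1) hc.2 hx1.le
    rw [eq_div_iff (by linarith)] at hslope
    nlinarith
  · rw [h]
  · obtain ⟨c, hc, hslope⟩ := exists_hasDerivAt_eq_slope _ _ h (hcont x t hx0)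
      (fun z hz => hderiv z (hx0.trans hz.1))
    have hneg := sub_log_lt_of_lt hx0 hc.1 (hc.2.trans ht1).le
    rw [eq_div_iff (by linarith)] at hslope
    nlinarith

/-! ### Limits of the maxima -/

theorem tendsto_maxRewardAt_one :
    Tendsto (fun n : ℕ => maxRewardAt n 1 1 / (n : ℝ)) atTop (𝓝 (1 / Real.exp 1)) := by
  have he : 1 < Real.exp 1 := Real.one_lt_exp_iff.2 one_pos
  have h := tendsto_maxRewardAt_div (d := 1) (l := 1) le_rfl (f := Real.negMulLog)
    (x := 1 / Real.exp 1) (C := 1) (by positivity) ((div_lt_one (by positivity)).2 he)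
    Real.continuous_negMulLog.continuousAt
    (fun t ht _ => by rw [negMulLog_one_div_exp]; exact negMulLog_le_one_div_exp ht)
    (fun n k hk hkn => abs_expectedReward_one_le hk hkn)
  rwa [negMulLog_one_div_exp] at h

theorem tendsto_maxRewardAt_two_one {x : ℝ} (hx0 : 0 < x) (hx1 : x < 1)
    (hx : 2 * x - 2 * Real.log x = 3) :
    Tendsto (fun n : ℕ => maxRewardAt n 2 1 / (n : ℝ)) atTop (𝓝 (2 * x - x ^ 2)) := by
  rw [← two_negMulLog_sub_eq hx]
  refine tendsto_maxRewardAt_div (f := fun t => 2 * Real.negMulLog t - t * (1 - t)) le_rfl hx0 hx1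
    ?_ (fun t ht0 ht1 => two_negMulLog_sub_le hx0 hx1 hx ht0 ht1)
    (fun n k hk hkn => abs_expectedReward_two_one_le hk hkn)
  have := Real.continuous_negMulLog
  exact Continuous.continuousAt (by fun_prop)

theorem tendsto_maxRewardAt_two_two :
    Tendsto (fun n : ℕ => maxRewardAt n 2 2 / (n : ℝ)) atTop (𝓝 (1 / 2)) := by
  have h := tendsto_maxRewardAt_div (d := 2) (l := 2) one_le_two
    (f := fun t => 2 * (t * (1 - t))) (x := 1 / 2) (C := 1) (by norm_num) (by norm_num)
    (Continuous.continuousAt (by fun_prop)) (fun t _ _ => by nlinarith [sq_nonneg (2 * t - 1)])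
    (fun n k hk hkn => abs_expectedReward_two_two_le hk hkn)
  norm_num at h ⊢
  exact h

theorem maxReward_one_eq {n : ℕ} (hn : 2 ≤ n) : maxReward n 1 = maxRewardAt n 1 1 := by
  refine (maxReward_isGreatest hn 1).unique ⟨?_, ?_⟩
  · obtain ⟨k, h1, h2, h3, h4⟩ := (maxRewardAt_isGreatest le_rfl hn 1).1
    exact ⟨k, 1, h1, h2, h3, h4⟩
  · rintro _ ⟨k, l, hl, hlk, hkn, rfl⟩
    exact (expectedReward_anti le_rfl le_rfl hl hlk hkn).trans
      ((maxRewardAt_isGreatest le_rfl hn 1).2 ⟨k, le_rfl, hl.trans hlk, hkn, rfl⟩)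

/-- By monotonicity every `l ≥ 2` is dominated by `l = 2`, which loses to `l = 1` under `h`; the
limits provide `h` for large `n`. -/
theorem maxReward_two_eq {n : ℕ} (hn : 3 ≤ n) (h : maxRewardAt n 2 2 < maxRewardAt n 2 1) :
    maxReward n 2 = maxRewardAt n 2 1 := by
  have hg1 := maxRewardAt_isGreatest le_rfl (by omega : 1 < n) 2
  have hg2 := maxRewardAt_isGreatest one_le_two (by omega : 2 < n) 2
  refine (maxReward_isGreatest (by omega) 2).unique ⟨?_, ?_⟩
  · obtain ⟨k, h1, h2, h3, h4⟩ := hg1.1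
    exact ⟨k, 1, h1, h2, h3, h4⟩
  · rintro _ ⟨k, l, hl, hlk, hkn, rfl⟩
    rcases hl.eq_or_lt with rfl | hl
    · exact hg1.2 ⟨k, le_rfl, hlk, hkn, rfl⟩
    · exact ((expectedReward_anti one_le_two le_rfl hl hlk hkn).trans
        (hg2.2 ⟨k, one_le_two, Nat.le_trans hl hlk, hkn, rfl⟩)).trans h.le

end Secretary

theorem theorem3 :
    -- d = 1
    (Tendsto (fun n : ℕ => Secretary.maxReward n 1 / (n : ℝ)) atTop (𝓝 (1 / Real.exp 1)) ∧
      |1 / Real.exp 1 - 0.36788| < 0.000005 ∧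
      -- for fixed n and k, the choice l = 1 is optimal
      ∀ n k l : ℕ, 1 ≤ l → l ≤ k → k < n →
        Secretary.expectedReward n 1 k l ≤ Secretary.expectedReward n 1 k 1) ∧
    -- d = 2
    ∃ x y : ℝ,
      -- the equation has exactly two roots, and x is the smaller one
      x < y ∧ {z : ℝ | 0 < z ∧ 2 * z - 2 * Real.log z = 3} = {x, y} ∧
      |x - 0.30171| < 0.000005 ∧
      Tendsto (fun n : ℕ => Secretary.maxReward n 2 / (n : ℝ)) atTop (𝓝 (2 * x - x ^ 2)) ∧
      |(2 * x - x ^ 2) - 0.51239| < 0.000005 ∧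
      -- for fixed n and k, the expected reward is decreasing in l for l ≥ 2
      (∀ n k l l' : ℕ, 2 ≤ l → l ≤ l' → l' ≤ k → k < n →
        Secretary.expectedReward n 2 k l' ≤ Secretary.expectedReward n 2 k l) ∧
      -- the maxima for l = 1 and for l = 2
      Tendsto (fun n : ℕ => Secretary.maxRewardAt n 2 1 / (n : ℝ)) atTop (𝓝 (2 * x - x ^ 2)) ∧
      Tendsto (fun n : ℕ => Secretary.maxRewardAt n 2 2 / (n : ℝ)) atTop (𝓝 (1 / 2)) ∧
      ∀ᶠ n : ℕ in atTop, Secretary.maxRewardAt n 2 2 < Secretary.maxRewardAt n 2 1 := by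
  obtain ⟨x, hx1, hx2, hx⟩ := Secretary.exists_small_root
  obtain ⟨y, hy1, hy⟩ := Secretary.exists_large_root
  have hx0 : 0 < x := by norm_num at hx1; linarith
  have hxlt : x < 1 := by norm_num at hx2; linarith
  have h21 := Secretary.tendsto_maxRewardAt_two_one hx0 hxlt hx
  have h22 := Secretary.tendsto_maxRewardAt_two_two
  have hlt : ∀ᶠ n : ℕ in atTop, Secretary.maxRewardAt n 2 2 < Secretary.maxRewardAt n 2 1 := by
    -- A strict gap between the two limits separates the maxima for large `n`.
    have hhalf : (1 : ℝ) / 2 < 2 * x - x ^ 2 := by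
      norm_num at hx1 hx2
      nlinarith
    filter_upwards [h22.eventually_lt h21 hhalf, eventually_gt_atTop 0] with n hn hn0
    exact (div_lt_div_iff_of_pos_right (by exact_mod_cast hn0)).1 hn
  refine ⟨⟨?_, ?_, fun n k l hl hlk hkn => Secretary.expectedReward_anti le_rfl le_rfl hl hlk hkn⟩,
    x, y, hxlt.trans hy1, Secretary.setOf_root_eq hx0 hxlt hy1 hx hy, ?_, ?_, ?_,
    fun n k l l' hl hll hlk hkn =>
      Secretary.expectedReward_anti (one_le_two.trans hl) hl hll hlk hkn,
    h21, h22, hlt⟩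
  · refine Secretary.tendsto_maxRewardAt_one.congr' ?_
    filter_upwards [eventually_ge_atTop 2] with n hn
    rw [Secretary.maxReward_one_eq hn]
  · have h1 := Real.exp_one_gt_d9
    have h2 := Real.exp_one_lt_d9
    have he := Real.exp_pos 1
    rw [abs_lt, lt_sub_iff_add_lt, sub_lt_iff_lt_add, lt_div_iff₀ he, div_lt_iff₀ he]
    norm_num at *
    exact ⟨by linarith, by linarith⟩
  · rw [abs_lt]
    norm_num at *
    exact ⟨by linarith, by linarith⟩
  · refine h21.congr' ?_
    filter_upwards [hlt, eventually_ge_atTop 3] with n hn hn3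
    rw [Secretary.maxReward_two_eq hn3 hn]
  · rw [abs_lt]
    norm_num at hx1 hx2 ⊢
    exact ⟨by nlinarith, by nlinarith⟩
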